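/- All graphs are undirected and loopless. A homomorphism of graphs is a map of vertices preserving adjacency; a monomorphism is an injective homomorphism. Let $G$ be a countably infinite graph. Say that $G$ is HE-homogeneous (respectively ME-homogeneous) if every homomorphism (respectively every monomorphism) $f\colon A\to B$ between finite induced subgraphs $A,B$ of $G$ is the restriction of a surjective endomorphism $G\to G$, and that $G$ is MB-homogeneous if every monomorphism between finite induced subgraphs of $G$ is the restriction of a bijective endomorphism $G\to G$ (whose inverse need not be a homomorphism). For $n\in\mathbb{N}$ let $I_\omega[K_n]$ denote the disjoint union of countably infinitely many copies of the complete graph $K_n$, with no edges between different copies. Theorem. For every countably infinite graph $G$: 1. $G$ is ME-homogeneous if and only if it is HE-homogeneous; 2. $G$ is HE-homogeneous if and only if it is MB-homogeneous or isomorphic to $I_\omega[K_n]$ for some finite $n\ge 2$; 3. $G$ is ME-homogeneous (equivalently, HE-homogeneous) but not MB-homogeneous if and only if $G$ is isomorphic to $I_\omega[K_n]$ for some finite $n\geq 2$. In other words, in the class of countably infinite graphs, up to isomorphism, $\mathrm{ME}=\mathrm{HE}=\mathrm{MB}\cup\{I_\omega[K_n]: 2\le n<\omega\}$, and this union is disjoint.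 -/

import Mathlib

namespace GraphHomogeneity

/-- The lexicographic product (graph composite) `G[H]`: pairs `(g, h)` and `(g', h')` are adjacent
if `g ∼ g'` in `G`, or `g = g'` and `h ∼ h'` in `H`. -/
def lexProd {α β : Type*} (G : SimpleGraph α) (H : SimpleGraph β) : SimpleGraph (α × β) where
  Adj x y := G.Adj x.1 y.1 ∨ (x.1 = y.1 ∧ H.Adj x.2 y.2)
  symm := ⟨by
    rintro x y (h | ⟨h, h'⟩)
    · exact Or.inl h.symm
    · exact Or.inr ⟨h.symm, h'.symm⟩⟩
  loopless := ⟨by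
    rintro x (h | ⟨_, h⟩)
    · exact G.loopless.irrefl _ h
    · exact H.loopless.irrefl _ h⟩

/-- `I_ω[K_n]`: the disjoint union of countably infinitely many copies of the clique `K_n`. -/
def cliqueCopies (n : ℕ) : SimpleGraph (ℕ × Fin n) :=
  lexProd (⊥ : SimpleGraph ℕ) (⊤ : SimpleGraph (Fin n))

/-- ME-homogeneous: every monomorphism (injective homomorphism) between finite induced subgraphs
is the restriction of an epimorphism (surjective endomorphism). -/
def IsMEHomogeneous {V : Type*} (G : SimpleGraph V) : Prop :=
  ∀ A B : Set V, A.Finite → B.Finite → ∀ f : G.induce A →g G.induce B, Function.Injective f →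
    ∃ F : G →g G, Function.Surjective F ∧ ∀ a : A, F (a : V) = (f a : V)

/-- HE-homogeneous: every homomorphism between finite induced subgraphs
is the restriction of an epimorphism (surjective endomorphism). -/
def IsHEHomogeneous {V : Type*} (G : SimpleGraph V) : Prop :=
  ∀ A B : Set V, A.Finite → B.Finite → ∀ f : G.induce A →g G.induce B,
    ∃ F : G →g G, Function.Surjective F ∧ ∀ a : A, F (a : V) = (f a : V)

/-- MB-homogeneous: every monomorphism (injective homomorphism) between finite induced subgraphs
is the restriction of a bimorphism (bijective endomorphism, whose inverse need not be a
homomorphism). -/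
def IsMBHomogeneous {V : Type*} (G : SimpleGraph V) : Prop :=
  ∀ A B : Set V, A.Finite → B.Finite → ∀ f : G.induce A →g G.induce B, Function.Injective f →
    ∃ F : G →g G, Function.Bijective F ∧ ∀ a : A, F (a : V) = (f a : V)

end GraphHomogeneity

/-!
Write `H` for the complement of an ME-homogeneous graph `G`. A surjective endomorphism gives two
symmetric facts (`TransfersCommonNbrs`): if a finite set has a common neighbour in `G`, so does its
image under any monomorphism, and the same holds in `H`, by extending inverse maps and taking
preimages. By back and forth, HE-homogeneity follows as soon as each finite partial homomorphism can
be extended by a pair with a prescribed new value (`ExtendsBack`), and MB-homogeneity follows if one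
can also assign a new value to each prescribed new vertex (`ExtendsForth`).

If neither `G` nor `H` is a disjoint union of cliques, then every finite set has a common neighbour
in `G` and one in `H` (`hasCommonNbrs_and_compl`), and both extension properties are immediate. By
Ramsey's theorem one of the two graphs, say `G`, has arbitrarily large independent sets. If
arbitrarily large independent sets of `G` have common neighbours, these can be transferred to all
finite sets. Otherwise let `m + 2` be the largest size of an independent set with a common
neighbour; it is at least `2` since `G` contains an induced path. Now every set of `m + 2` vertices
has a common neighbour; transferring common neighbours of suitable sparse configurations shows that
a clique with `m + 1` further vertices has one, and so have two edges with `m` further vertices.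
This allows attaching a triangle to an independent set in such a way that no vertex can be
adjacent both to the triangle and to `m + 1` suitable elements of the independent set
(`not_forall_card_eq_exists_nbr`).

If `G` is a disjoint union of cliques and not complete, it has infinitely many components
(`IsCliqueUnion.hasIsolatedVertices`), which gives `ExtendsBack`, and the cliques all have the same
size by ME-homogeneity. So either `ExtendsForth` holds, or `G` is `I_ω[K_n]` for some finite `n ≥ 2`.
If `H` is a disjoint union of cliques and not complete, then every finite set has a common neighbour
in `G` by the same lemma for `H`; the parts of `G` are trivial or infinite
(`IsMEHomogeneous.infinite_part`), and this yields `ExtendsBack`.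
-/

namespace GraphHomogeneity

variable {V : Type*} {G : SimpleGraph V}

/-! ### Transferring common neighbours along monomorphisms -/

/-- If a finite set has a common neighbour, then so has every image of it under a monomorphism.
For every ME-homogeneous graph both the graph and its complement have this property. -/
def TransfersCommonNbrs (G : SimpleGraph V) : Prop :=
  ∀ (s : Set V), s.Finite → ∀ f : V → V, Set.InjOn f s →
    (∀ a ∈ s, ∀ b ∈ s, G.Adj a b → G.Adj (f a) (f b)) →
    (∃ v, ∀ a ∈ s, G.Adj a v) → ∃ w, ∀ a ∈ s, G.Adj (f a) w

/-- Every finite set has a common neighbour. -/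
def HasCommonNbrs (G : SimpleGraph V) : Prop :=
  ∀ S : Finset V, ∃ w, ∀ s ∈ S, G.Adj s w

/-- Every finite set `T` has a vertex outside `T` that is adjacent to no element of `T`. -/
def HasIsolatedVertices (G : SimpleGraph V) : Prop :=
  ∀ T : Finset V, ∃ v ∉ T, ∀ t ∈ T, ¬ G.Adj t v

/-- Adjacency-or-equality is transitive: `G` is a disjoint union of complete graphs. -/
def IsCliqueUnion (G : SimpleGraph V) : Prop :=
  ∀ ⦃a b c⦄, G.Adj a b → G.Adj b c → a ≠ c → G.Adj a c

theorem hasIsolatedVertices_iff_compl : HasIsolatedVertices G ↔ HasCommonNbrs Gᶜ := by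
  refine forall_congr' fun T => exists_congr fun v => ?_
  simp only [SimpleGraph.compl_adj]
  constructor
  · rintro ⟨h, h'⟩ t ht
    exact ⟨fun e => h (e ▸ ht), h' t ht⟩
  · intro h
    exact ⟨fun hv => (h v hv).1 rfl, fun t ht => (h t ht).2⟩

/-- The indexed form of `TransfersCommonNbrs`. -/
theorem TransfersCommonNbrs.family (h : TransfersCommonNbrs G) {ι : Type*} [Finite ι]
    {x y : ι → V} (hx : Function.Injective x) (hy : Function.Injective y)
    (hxy : ∀ i j, G.Adj (x i) (x j) → G.Adj (y i) (y j))
    (hv : ∃ v, ∀ i, G.Adj (x i) v) : ∃ w, ∀ i, G.Adj (y i) w := by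
  obtain ⟨w, hw⟩ := h (Set.range x) (Set.finite_range x) (Function.extend x y id)
    (by
      rintro _ ⟨i, rfl⟩ _ ⟨j, rfl⟩ e
      rw [hx.extend_apply, hx.extend_apply] at e
      rw [hy e])
    (by
      rintro _ ⟨i, rfl⟩ _ ⟨j, rfl⟩ e
      rw [hx.extend_apply, hx.extend_apply]
      exact hxy i j e)
    (by
      obtain ⟨v, hv⟩ := hv
      exact ⟨v, by rintro _ ⟨i, rfl⟩; exact hv i⟩)
  refine ⟨w, fun i => ?_⟩
  have := hw (x i) ⟨i, rfl⟩
  rwa [hx.extend_apply] at this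

/-- If the disjoint union of two cliques `K`, `L` and an independent set `Z`, with no edges between
the three, has a common neighbour, then so has every set composed of two cliques and some further
vertices in the same numbers. -/
theorem TransfersCommonNbrs.cliques (h : TransfersCommonNbrs G) {K L Z K' L' Z' : Finset V}
    (hKL : Disjoint K L) (hKZ : Disjoint K Z) (hLZ : Disjoint L Z)
    (hKL' : Disjoint K' L') (hKZ' : Disjoint K' Z') (hLZ' : Disjoint L' Z')
    (nKL : ∀ a ∈ K, ∀ b ∈ L, ¬ G.Adj a b) (nKZ : ∀ a ∈ K, ∀ b ∈ Z, ¬ G.Adj a b)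
    (nLZ : ∀ a ∈ L, ∀ b ∈ Z, ¬ G.Adj a b) (nZ : ∀ a ∈ Z, ∀ b ∈ Z, ¬ G.Adj a b)
    (cK : G.IsClique (K' : Set V)) (cL : G.IsClique (L' : Set V))
    (eK : K.card = K'.card) (eL : L.card = L'.card) (eZ : Z.card = Z'.card)
    (hv : ∃ v, (∀ a ∈ K, G.Adj a v) ∧ (∀ a ∈ L, G.Adj a v) ∧ ∀ a ∈ Z, G.Adj a v) :
    ∃ w, (∀ a ∈ K', G.Adj a w) ∧ (∀ a ∈ L', G.Adj a w) ∧ ∀ a ∈ Z', G.Adj a w := by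
  let eK := Finset.equivOfCardEq eK
  let eL := Finset.equivOfCardEq eL
  let eZ := Finset.equivOfCardEq eZ
  let x : (K ⊕ L) ⊕ Z → V := Sum.elim (Sum.elim (fun a => (a : V)) fun a => (a : V)) fun a => (a : V)
  let y : (K ⊕ L) ⊕ Z → V :=
    Sum.elim (Sum.elim (fun a => (eK a : V)) fun a => (eL a : V)) fun a => (eZ a : V)
  have hx : Function.Injective x := by
    refine Function.Injective.sumElim (Function.Injective.sumElim Subtype.val_injective
      Subtype.val_injective ?_) Subtype.val_injective ?_
    · exact fun a b => Finset.disjoint_left.1 hKL a.2 |> fun hn e => hn (e ▸ b.2)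
    · rintro (a | a) b e
      · exact Finset.disjoint_left.1 hKZ a.2 ((show (a : V) = b from e) ▸ b.2)
      · exact Finset.disjoint_left.1 hLZ a.2 ((show (a : V) = b from e) ▸ b.2)
  have hy : Function.Injective y := by
    refine Function.Injective.sumElim (Function.Injective.sumElim
      (Subtype.val_injective.comp eK.injective) (Subtype.val_injective.comp eL.injective) ?_)
      (Subtype.val_injective.comp eZ.injective) ?_
    · exact fun a b => Finset.disjoint_left.1 hKL' (eK a).2 |> fun hn e => hn (e ▸ (eL b).2)
    · rintro (a | a) b e
      · exact Finset.disjoint_left.1 hKZ' (eK a).2 ((show (eK a : V) = eZ b from e) ▸ (eZ b).2)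
      · exact Finset.disjoint_left.1 hLZ' (eL a).2 ((show (eL a : V) = eZ b from e) ▸ (eZ b).2)
  obtain ⟨v, v1, v2, v3⟩ := hv
  obtain ⟨w, hw⟩ := h.family hx hy
    (by
      rintro ((a | a) | a) ((b | b) | b) e
      · exact cK (eK a).2 (eK b).2 fun e' => e.ne (congrArg Subtype.val
          (eK.injective (Subtype.ext e')))
      · exact (nKL a a.2 b b.2 e).elim
      · exact (nKZ a a.2 b b.2 e).elim
      · exact (nKL b b.2 a a.2 e.symm).elim
      · exact cL (eL a).2 (eL b).2 fun e' => e.ne (congrArg Subtype.val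
          (eL.injective (Subtype.ext e')))
      · exact (nLZ a a.2 b b.2 e).elim
      · exact (nKZ b b.2 a a.2 e.symm).elim
      · exact (nLZ b b.2 a a.2 e.symm).elim
      · exact (nZ a a.2 b b.2 e).elim)
    ⟨v, by
      rintro ((a | a) | a)
      · exact v1 a a.2
      · exact v2 a a.2
      · exact v3 a a.2⟩
  refine ⟨w, fun a ha => ?_, fun a ha => ?_, fun a ha => ?_⟩
  · simpa [y] using hw (.inl (.inl (eK.symm ⟨a, ha⟩)))
  · simpa [y] using hw (.inl (.inr (eL.symm ⟨a, ha⟩)))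
  · simpa [y] using hw (.inr (eZ.symm ⟨a, ha⟩))

theorem HasIsolatedVertices.exists_indep (h : HasIsolatedVertices G) (T : Finset V) (n : ℕ) :
    ∃ Z : Finset V, Z.card = n ∧ Disjoint T Z ∧ (∀ a ∈ T, ∀ b ∈ Z, ¬ G.Adj a b) ∧
      ∀ a ∈ Z, ∀ b ∈ Z, ¬ G.Adj a b := by
  classical
  induction n with
  | zero => exact ⟨∅, by simp⟩
  | succ n ih =>
    obtain ⟨Z, h1, h2, h3, h4⟩ := ih
    obtain ⟨v, hv, hv'⟩ := h (T ∪ Z)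
    simp only [Finset.mem_union, not_or] at hv
    refine ⟨insert v Z, by simp [hv.2, h1], ?_, ?_, ?_⟩
    · rw [Finset.disjoint_insert_right]; exact ⟨hv.1, h2⟩
    · intro a ha b hb
      rcases Finset.mem_insert.1 hb with rfl | hb
      · exact hv' a (Finset.mem_union_left _ ha)
      · exact h3 a ha b hb
    · intro a ha b hb
      rcases Finset.mem_insert.1 ha with rfl | ha' <;> rcases Finset.mem_insert.1 hb with rfl | hb'
      · exact G.irrefl
      · exact fun e => hv' b (Finset.mem_union_right _ hb') e.symm
      · exact hv' a (Finset.mem_union_right _ ha')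
      · exact h4 a ha' b hb'

/-! ### Graphs without large independent neighbourhoods -/

/-- Every clique of size `a` together with `m + 1` further vertices has a common neighbour. -/
def CliquesHaveNbrs (G : SimpleGraph V) (m a : ℕ) : Prop :=
  ∀ K Z : Finset V, G.IsClique (K : Set V) → K.card = a → Z.card = m + 1 → Disjoint K Z →
    ∃ w, (∀ s ∈ K, G.Adj s w) ∧ ∀ s ∈ Z, G.Adj s w

theorem CliquesHaveNbrs.succ {m a : ℕ} (hT : TransfersCommonNbrs G) (hI : HasIsolatedVertices G)
    (hstar : ∀ S : Finset V, S.card = m + 3 → (∀ a ∈ S, ∀ b ∈ S, ¬ G.Adj a b) →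
      ¬ ∃ w, ∀ s ∈ S, G.Adj s w)
    (hP : CliquesHaveNbrs G m a) {K : Finset V} (hK : G.IsClique (K : Set V)) (hKa : K.card = a)
    (ha : 0 < a) :
    CliquesHaveNbrs G m (a + 1) ∧ ∃ K' : Finset V, G.IsClique (K' : Set V) ∧ K'.card = a + 1 := by
  classical
  obtain ⟨x, hx⟩ : K.Nonempty := Finset.card_pos.1 (hKa ▸ ha)
  -- Pick common neighbours of `K` and of fresh independent sets one at a time: as all of them lie
  -- in the neighbourhood of `x`, two of them must eventually be adjacent.
  obtain ⟨u, w, Z, hu, huw, hwK, hwZ, hZ, hd, hKZ, hZZ⟩ : ∃ (u w : V) (Z : Finset V),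
      (∀ s ∈ K, G.Adj s u) ∧ G.Adj u w ∧ (∀ s ∈ K, G.Adj s w) ∧ (∀ s ∈ Z, G.Adj s w) ∧
      Z.card = m + 1 ∧ Disjoint (insert u K) Z ∧ (∀ s ∈ insert u K, ∀ z ∈ Z, ¬ G.Adj s z) ∧
      ∀ z ∈ Z, ∀ z' ∈ Z, ¬ G.Adj z z' := by
    by_contra hcon
    have key : ∀ n, ∃ W : Finset V, W.card = n ∧ (∀ a ∈ W, ∀ b ∈ W, ¬ G.Adj a b) ∧
        ∀ a ∈ W, ∀ s ∈ K, G.Adj s a := by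
      intro n
      induction n with
      | zero => exact ⟨∅, by simp⟩
      | succ n ih =>
        obtain ⟨W, h1, h2, h3⟩ := ih
        obtain ⟨Z, z1, z2, z3, z4⟩ := hI.exists_indep (K ∪ W) (m + 1)
        obtain ⟨w, w1, w2⟩ := hP K Z hK hKa z1 (z2.mono_left Finset.subset_union_left)
        have hW : ∀ a ∈ W, ¬ G.Adj a w := by
          intro u hu huw
          have hsub : insert u K ⊆ K ∪ W := by
            intro s hs
            rcases Finset.mem_insert.1 hs with rfl | hs
            · exact Finset.mem_union_right _ hu
            · exact Finset.mem_union_left _ hs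
          exact hcon ⟨u, w, Z, h3 u hu, huw, w1, w2, z1, z2.mono_left hsub,
            fun s hs => z3 s (hsub hs), z4⟩
        have hwW : w ∉ W := by
          intro hw
          obtain ⟨z, hz⟩ : Z.Nonempty := Finset.card_pos.1 (by omega)
          exact z3 w (Finset.mem_union_right _ hw) z hz (w2 z hz).symm
        refine ⟨insert w W, by simp [hwW, h1], ?_, ?_⟩
        · intro a ha b hb
          rcases Finset.mem_insert.1 ha with rfl | ha' <;>
            rcases Finset.mem_insert.1 hb with rfl | hb'
          · exact G.irrefl
          · exact fun e => hW b hb' e.symm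
          · exact hW a ha'
          · exact h2 a ha' b hb'
        · intro a ha
          rcases Finset.mem_insert.1 ha with rfl | ha
          · exact w1
          · exact h3 a ha
    obtain ⟨W, h1, h2, h3⟩ := key (m + 3)
    exact hstar W h1 h2 ⟨x, fun a ha => (h3 a ha x hx).symm⟩
  have huK : u ∉ K := fun h => G.irrefl (hu u h)
  have hcard : (insert u K).card = a + 1 := by simp [huK, hKa]
  refine ⟨?_, insert u K, ?_, hcard⟩
  · intro K' Z' hK' hK'a hZ' hd'
    obtain ⟨v, h1, -, h3⟩ := hT.cliques (K := insert u K) (L := ∅) (Z := Z) (K' := K') (L' := ∅)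
      (Z' := Z') (by simp) hd (by simp) (by simp) hd' (by simp) (by simp) hKZ (by simp) hZZ hK'
      (by simp) (by omega) rfl (by omega)
      ⟨w, by
        intro s hs
        rcases Finset.mem_insert.1 hs with rfl | hs
        · exact huw
        · exact hwK s hs, by simp, hwZ⟩
    exact ⟨v, h1, h3⟩
  · rw [Finset.coe_insert]
    exact hK.insert fun b hb _ => (hu b hb).symm

/-- Any two disjoint edges together with `m` further vertices have a common neighbour. -/
def EdgePairsHaveNbrs (G : SimpleGraph V) (m : ℕ) : Prop :=
  ∀ (p q r s : V) (Z : Finset V), Z.card = m → G.Adj p q → G.Adj r s →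
    p ≠ r → p ≠ s → q ≠ r → q ≠ s → p ∉ Z → q ∉ Z → r ∉ Z → s ∉ Z →
    ∃ w, G.Adj p w ∧ G.Adj q w ∧ G.Adj r w ∧ G.Adj s w ∧ ∀ z ∈ Z, G.Adj z w

/-- It suffices to find one common neighbour of an induced matching of two edges together with `m`
independent vertices not adjacent to it. -/
theorem TransfersCommonNbrs.edgePairsHaveNbrs {m : ℕ} (hT : TransfersCommonNbrs G) {p q r s u : V}
    {Z : Finset V} (hZ : Z.card = m) (hpq : G.Adj p q) (hrs : G.Adj r s)
    (hpr : ¬ G.Adj p r) (hps : ¬ G.Adj p s) (hqr : ¬ G.Adj q r) (hqs : ¬ G.Adj q s)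
    (npr : p ≠ r) (nps : p ≠ s) (nqr : q ≠ r) (nqs : q ≠ s)
    (hpZ : p ∉ Z) (hqZ : q ∉ Z) (hrZ : r ∉ Z) (hsZ : s ∉ Z)
    (hpZ' : ∀ z ∈ Z, ¬ G.Adj p z) (hqZ' : ∀ z ∈ Z, ¬ G.Adj q z) (hrZ' : ∀ z ∈ Z, ¬ G.Adj r z)
    (hsZ' : ∀ z ∈ Z, ¬ G.Adj s z) (hZZ : ∀ z ∈ Z, ∀ z' ∈ Z, ¬ G.Adj z z')
    (hp : G.Adj p u) (hq : G.Adj q u) (hr : G.Adj r u) (hs : G.Adj s u)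
    (hZu : ∀ z ∈ Z, G.Adj z u) :
    EdgePairsHaveNbrs G m := by
  classical
  intro p' q' r' s' Z' hZ' hpq' hrs' npr' nps' nqr' nqs' hp' hq' hr' hs'
  obtain ⟨w, h1, h2, h3⟩ := hT.cliques (K := {p, q}) (L := {r, s}) (Z := Z) (K' := {p', q'})
    (L' := {r', s'}) (Z' := Z') (by simp [*]; tauto) (by simp [*]) (by simp [*]) (by simp [*]; tauto)
    (by simp [*])
    (by simp [*]) (by simp [*]) (by simp [*]; tauto) (by simp [*]; tauto) hZZ
    (by simp [hpq'])
    (by simp [hrs']) (by rw [Finset.card_pair hpq.ne, Finset.card_pair hpq'.ne])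
    (by rw [Finset.card_pair hrs.ne, Finset.card_pair hrs'.ne]) (by omega)
    ⟨u, by simp [*], by simp [*], hZu⟩
  exact ⟨w, h1 p' (by simp), h1 q' (by simp), h2 r' (by simp), h2 s' (by simp), h3⟩

theorem edgePairsHaveNbrs {m : ℕ} (hT : TransfersCommonNbrs G) (hI : HasIsolatedVertices G)
    (hall : ∀ S : Finset V, S.card = m + 2 → ∃ w, ∀ s ∈ S, G.Adj s w)
    (hstar : ∀ S : Finset V, S.card = m + 3 → (∀ a ∈ S, ∀ b ∈ S, ¬ G.Adj a b) →
      ¬ ∃ w, ∀ s ∈ S, G.Adj s w)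
    (h2 : CliquesHaveNbrs G m 2) (h3 : CliquesHaveNbrs G m 3) {d e : V} (hde : G.Adj d e) :
    EdgePairsHaveNbrs G m := by
  classical
  -- `y` is a common neighbour of the edge `de` and of `m` independent vertices.
  obtain ⟨Z₀, a1, a2, a3, a4⟩ := hI.exists_indep {d, e} (m + 1)
  obtain ⟨y, hy, hyZ⟩ := h2 {d, e} Z₀ (by simp [hde]) (Finset.card_pair hde.ne) a1 a2
  obtain ⟨Z', hZ'sub, hZ'⟩ := Finset.exists_subset_card_eq (show m ≤ Z₀.card by omega)
  have hdy : G.Adj d y := hy d (by simp)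
  have hey : G.Adj e y := hy e (by simp)
  set T : Finset V := insert d (insert e Z') with hTdef
  have hTy : ∀ t ∈ T, G.Adj t y := by
    intro t ht
    simp only [hTdef, Finset.mem_insert] at ht
    rcases ht with rfl | rfl | ht
    · exact hdy
    · exact hey
    · exact hyZ t (hZ'sub ht)
  -- `cv` is an edge far from all of these: a vertex outside `C` that is adjacent to `v` is adjacent
  -- to some element of `C`, as no larger independent set than `C` has a common neighbour.
  obtain ⟨C, c1, c2, c3, c4⟩ := hI.exists_indep (insert y T) (m + 2)
  obtain ⟨v, hv⟩ := hall C c1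
  obtain ⟨c, hc⟩ : C.Nonempty := Finset.card_pos.1 (by omega)
  have hcv : G.Adj c v := hv c hc
  have hTv : ∀ t ∈ insert y T, ¬ G.Adj t v := by
    intro t ht htv
    have htC : t ∉ C := Finset.disjoint_left.1 c2 ht
    refine hstar (insert t C) (by simp [htC, c1]) ?_ ⟨v, ?_⟩
    · intro a ha b hb
      rcases Finset.mem_insert.1 ha with rfl | ha' <;> rcases Finset.mem_insert.1 hb with rfl | hb'
      · exact G.irrefl
      · exact c3 a ht b hb'
      · exact fun e => c3 b ht a ha' e.symm
      · exact c4 a ha' b hb'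
    · intro a ha
      rcases Finset.mem_insert.1 ha with rfl | ha'
      · exact htv
      · exact hv a ha'
  have hvT : v ∉ insert y T := fun h => c3 v h c hc hcv.symm
  have hTc : ∀ t ∈ insert y T, ¬ G.Adj t c := fun t ht => c3 t ht c hc
  have hcT : c ∉ insert y T := fun h => Finset.disjoint_left.1 c2 h hc
  obtain ⟨Z, z1, z2, z3, z4⟩ := hI.exists_indep (insert c (insert v (insert y T))) m
  have hcZ : c ∉ Z := Finset.disjoint_left.1 z2 (by simp)
  have hvZ : v ∉ Z := Finset.disjoint_left.1 z2 (by simp)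
  have hyZn : y ∉ Z := Finset.disjoint_left.1 z2 (by simp)
  have hyc : y ≠ c := fun h => hcT (h ▸ Finset.mem_insert_self _ _)
  have hyv : y ≠ v := fun h => hvT (h ▸ Finset.mem_insert_self _ _)
  -- A common neighbour `u` of `c`, `v`, `y` and `Z` is adjacent to no element of `T`,
  -- or the claim follows from the edges `cv` and `yt` for some `t ∈ T`.
  have key : ∀ u, G.Adj c u → G.Adj v u → G.Adj y u → (∀ z ∈ Z, G.Adj z u) →
      (∀ t ∈ T, ¬ G.Adj t u) ∨ EdgePairsHaveNbrs G m := by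
    intro u hcu hvu hyu hZu
    by_contra hcon
    push Not at hcon
    obtain ⟨⟨t, ht, htu⟩, hn⟩ := hcon
    have ht' : t ∈ insert y T := Finset.mem_insert_of_mem ht
    refine hn (hT.edgePairsHaveNbrs z1 hcv (hTy t ht).symm
      (fun h => hTc y (by simp) h.symm) (fun h => hTc t ht' h.symm)
      (fun h => hTv y (by simp) h.symm) (fun h => hTv t ht' h.symm)
      hyc.symm (fun h => hcT (h ▸ ht')) hyv.symm (fun h => hvT (h ▸ ht'))
      hcZ hvZ hyZn (Finset.disjoint_left.1 z2 (by simp [ht]))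
      (z3 c (by simp)) (z3 v (by simp)) (z3 y (by simp)) (z3 t (by simp [ht])) z4
      hcu hvu hyu htu hZu)
  have hcard : (insert y Z).card = m + 1 := by simp [hyZn, z1]
  obtain ⟨u, u1, u2⟩ := h2 {c, v} (insert y Z) (by simp [hcv]) (Finset.card_pair hcv.ne) hcard
    (by simp [hcZ, hvZ, hyc, hyv])
  have hcu : G.Adj c u := u1 c (by simp)
  have hvu : G.Adj v u := u1 v (by simp)
  have hyu : G.Adj y u := u2 y (by simp)
  have hZu : ∀ z ∈ Z, G.Adj z u := fun z hz => u2 z (by simp [hz])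
  have huZ : u ∉ Z := fun h => G.irrefl (hZu u h)
  obtain ⟨u', u'1, u'2⟩ := h3 {c, v, u} (insert y Z) (by
      simp only [Finset.coe_insert, Finset.coe_singleton]
      refine SimpleGraph.IsClique.insert ?_ ?_
      · simp [hvu]
      · simp [hcv, hcu])
    (Finset.card_eq_three.2 ⟨c, v, u, hcv.ne, hcu.ne, hvu.ne, rfl⟩) hcard
    (by simp [hcZ, hvZ, huZ, hyc, hyv, hyu.ne])
  have hcu' : G.Adj c u' := u'1 c (by simp)
  have hvu' : G.Adj v u' := u'1 v (by simp)
  have huu' : G.Adj u u' := u'1 u (by simp)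
  have hyu' : G.Adj y u' := u'2 y (by simp)
  have hZu' : ∀ z ∈ Z, G.Adj z u' := fun z hz => u'2 z (by simp [hz])
  obtain hu | hdone := key u hcu hvu hyu hZu
  swap; · exact hdone
  obtain hu' | hdone := key u' hcu' hvu' hyu' hZu'
  swap; · exact hdone
  have ne : ∀ t ∈ T, ∀ x, G.Adj c x → t ≠ x := fun t ht x hx h =>
    hTc t (Finset.mem_insert_of_mem ht) (h ▸ hx.symm)
  have hd : d ∈ T := by simp [hTdef]
  have he : e ∈ T := by simp [hTdef]
  have hZT : ∀ z ∈ Z', z ∈ T := fun z hz => by simp [hTdef, hz]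
  exact hT.edgePairsHaveNbrs hZ' hde huu' (hu d hd) (hu' d hd) (hu e he) (hu' e he)
    (ne d hd u hcu) (ne d hd u' hcu') (ne e he u hcu) (ne e he u' hcu')
    (fun h => Finset.disjoint_left.1 a2 (by simp) (hZ'sub h))
    (fun h => Finset.disjoint_left.1 a2 (by simp) (hZ'sub h))
    (fun h => ne u (hZT u h) u hcu rfl) (fun h => ne u' (hZT u' h) u' hcu' rfl)
    (fun z hz => a3 d (by simp) z (hZ'sub hz)) (fun z hz => a3 e (by simp) z (hZ'sub hz))
    (fun z hz h => hu z (hZT z hz) h.symm) (fun z hz h => hu' z (hZT z hz) h.symm)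
    (fun z hz z' hz' => a4 z (hZ'sub hz) z' (hZ'sub hz'))
    hdy hey hyu.symm hyu'.symm (fun z hz => hyZ z (hZ'sub hz))

/-- If `m + 2 ≥ 2` is the largest number of independent vertices in a neighbourhood, then not every
set of `m + 2` vertices has a common neighbour.

Among the elements of an independent set, a triangle `v₁`, `v₂`, `v₃` is attached to three
`(m + 2)`-sets `I₁`, `I₂`, `I₃` without an element common to all three. By maximality a neighbour
of `vᵢ` is adjacent to an element of `Iᵢ`; so a common neighbour of the `vᵢ` is adjacent to
two elements of their union, and therefore to at most `m` further elements of the independent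
set. But the triangle and any `m + 1` further vertices have a common neighbour. -/
theorem not_forall_card_eq_exists_nbr {m : ℕ} (hT : TransfersCommonNbrs G)
    (hI : HasIsolatedVertices G)
    (hall : ∀ S : Finset V, S.card = m + 2 → ∃ w, ∀ s ∈ S, G.Adj s w)
    (hstar : ∀ S : Finset V, S.card = m + 3 → (∀ a ∈ S, ∀ b ∈ S, ¬ G.Adj a b) →
      ¬ ∃ w, ∀ s ∈ S, G.Adj s w) : False := by
  classical
  have h1 : CliquesHaveNbrs G m 1 := by
    intro K Z _ hK hZ hd
    obtain ⟨w, hw⟩ := hall (K ∪ Z) (by rw [Finset.card_union_of_disjoint hd]; omega)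
    exact ⟨w, fun s hs => hw s (Finset.mem_union_left _ hs),
      fun s hs => hw s (Finset.mem_union_right _ hs)⟩
  obtain ⟨x, -⟩ := hI ∅
  obtain ⟨h2, K₂, hK₂, hK₂c⟩ := h1.succ hT hI hstar (K := {x}) (by simp) (by simp) (by simp)
  obtain ⟨h3, -⟩ := h2.succ hT hI hstar hK₂ hK₂c (by simp)
  obtain ⟨d, e, hne, rfl⟩ := Finset.card_eq_two.1 hK₂c
  have hQ := edgePairsHaveNbrs hT hI hall hstar h2 h3
    (hK₂ (by simp) (by simp) hne)
  -- Every other neighbour of a common neighbour of an independent `(m + 2)`-set is adjacent to an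
  -- element of this set.
  have trace : ∀ I : Finset V, I.card = m + 2 → (∀ a ∈ I, ∀ b ∈ I, ¬ G.Adj a b) →
      ∀ v, (∀ a ∈ I, G.Adj a v) → ∀ w, G.Adj v w → w ∉ I → ∃ i ∈ I, G.Adj i w := by
    intro I hIc hII v hv w hw hwI
    by_contra! hcon
    refine hstar (insert w I) (by simp [hwI, hIc]) ?_ ⟨v, ?_⟩
    · intro a ha b hb
      rcases Finset.mem_insert.1 ha with rfl | ha' <;> rcases Finset.mem_insert.1 hb with rfl | hb'
      · exact G.irrefl
      · exact fun e => hcon b hb' e.symm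
      · exact hcon a ha'
      · exact hII a ha' b hb'
    · intro a ha
      rcases Finset.mem_insert.1 ha with rfl | ha'
      · exact hw.symm
      · exact hv a ha'
  -- Three vertices `o`, `a`, `b`, three `m`-sets and an `(m + 1)`-set, jointly independent.
  have split : ∀ (p q : ℕ) (C : Finset V), C.card = p + q →
      ∃ A B : Finset V, A.card = p ∧ B.card = q ∧ Disjoint A B ∧ A ⊆ C ∧ B ⊆ C := by
    intro p q C hC
    obtain ⟨A, hA, hAp⟩ := Finset.exists_subset_card_eq (show p ≤ C.card by omega)
    exact ⟨A, C \ A, hAp, by rw [Finset.card_sdiff_of_subset hA]; omega, Finset.disjoint_sdiff,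
      hA, Finset.sdiff_subset⟩
  obtain ⟨C, hC, -, -, hCC⟩ := hI.exists_indep ∅ ((m + 1) + (m + (m + (m + 3))))
  obtain ⟨J, C₁, hJ, hC₁, dJ, sJ, sC₁⟩ := split _ _ C hC
  obtain ⟨R₁, C₂, hR₁, hC₂, dR₁, sR₁, sC₂⟩ := split _ _ C₁ hC₁
  obtain ⟨R₂, C₃, hR₂, hC₃, dR₂, sR₂, sC₃⟩ := split _ _ C₂ hC₂
  obtain ⟨R₃, C₄, hR₃, hC₄, dR₃, sR₃, sC₄⟩ := split _ _ C₃ hC₃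
  obtain ⟨o, a, b, hoa, hob, hab, rfl⟩ := Finset.card_eq_three.1 hC₄
  have o₃ : o ∈ C₃ := sC₄ (by simp)
  have a₃ : a ∈ C₃ := sC₄ (by simp)
  have b₃ : b ∈ C₃ := sC₄ (by simp)
  rw [Finset.disjoint_right] at dJ dR₁ dR₂ dR₃
  have oR₃ : o ∉ R₃ := dR₃ (by simp)
  have aR₃ : a ∉ R₃ := dR₃ (by simp)
  have bR₃ : b ∉ R₃ := dR₃ (by simp)
  have oR₂ : o ∉ R₂ := dR₂ o₃
  have aR₂ : a ∉ R₂ := dR₂ a₃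
  have bR₂ : b ∉ R₂ := dR₂ b₃
  have oR₁ : o ∉ R₁ := dR₁ (sC₃ o₃)
  have aR₁ : a ∉ R₁ := dR₁ (sC₃ a₃)
  have bR₁ : b ∉ R₁ := dR₁ (sC₃ b₃)
  have R₁₂ : ∀ x ∈ R₂, x ∉ R₁ := fun x hx => dR₁ (sR₂ hx)
  have R₁₃ : ∀ x ∈ R₃, x ∉ R₁ := fun x hx => dR₁ (sC₃ (sR₃ hx))
  have R₂₃ : ∀ x ∈ R₃, x ∉ R₂ := fun x hx => dR₂ (sR₃ hx)
  have o₁ : o ∈ C₁ := sC₂ (sC₃ o₃)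
  have a₁ : a ∈ C₁ := sC₂ (sC₃ a₃)
  have b₁ : b ∈ C₁ := sC₂ (sC₃ b₃)
  have notC : ∀ x ∈ C, ∀ v, G.Adj x v → v ∉ C := fun x hx v h hv => hCC x hx v hv h
  have sI₁ : insert o (insert a R₁) ⊆ C₁ := by simp [Finset.insert_subset_iff, o₁, a₁, sR₁]
  have sI₂ : insert o (insert b R₂) ⊆ C₁ := by
    simp [Finset.insert_subset_iff, o₁, b₁, sR₂.trans sC₂]
  have sI₃ : insert a (insert b R₃) ⊆ C₁ := by
    simp [Finset.insert_subset_iff, a₁, b₁, sR₃.trans (sC₃.trans sC₂)]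
  have cI₁ : (insert o (insert a R₁)).card = m + 2 := by simp [hoa, oR₁, aR₁, hR₁]
  have cI₂ : (insert o (insert b R₂)).card = m + 2 := by simp [hob, oR₂, bR₂, hR₂]
  have cI₃ : (insert a (insert b R₃)).card = m + 2 := by simp [hab, aR₃, bR₃, hR₃]
  obtain ⟨v₁, hv₁⟩ := hall _ cI₁
  have hv₁C : v₁ ∉ C := notC o (sC₁ o₁) v₁ (hv₁ o (by simp))
  have ho₁ : G.Adj v₁ o := (hv₁ o (by simp)).symm
  have hv₁' : ∀ x ∈ C, v₁ ≠ x := fun x hx h => hv₁C (h ▸ hx)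
  obtain ⟨v₂, h12, hv₂⟩ := h2 {v₁, o} (insert b R₂) (by simp [ho₁]) (Finset.card_pair ho₁.ne)
    (by simp [bR₂, hR₂]) (by
      simp only [Finset.disjoint_insert_left, Finset.disjoint_singleton_left, Finset.mem_insert,
        not_or]
      exact ⟨⟨hv₁' b (sC₁ b₁), fun h => hv₁C (sC₁ (sC₂ (sR₂ h)))⟩, hob, oR₂⟩)
  have hv₁₂ : G.Adj v₁ v₂ := h12 v₁ (by simp)
  have ho₂ : G.Adj o v₂ := h12 o (by simp)
  have hb₂ : G.Adj b v₂ := hv₂ b (by simp)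
  have hv₂C : v₂ ∉ C := notC o (sC₁ o₁) v₂ ho₂
  have hR₃C : R₃ ⊆ C := sR₃.trans (sC₃.trans (sC₂.trans sC₁))
  obtain ⟨v₃, h13, ha₃, h23, hb₃, hR₃'⟩ := hQ v₁ a v₂ b R₃ hR₃ (hv₁ a (by simp)).symm hb₂.symm
    hv₁₂.ne (hv₁' b (sC₁ b₁)) (fun h => hv₂C (h ▸ sC₁ a₁)) hab
    (fun h => hv₁C (hR₃C h)) aR₃ (fun h => hv₂C (hR₃C h)) bR₃
  have hv₃C : v₃ ∉ C := notC a (sC₁ a₁) v₃ ha₃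
  obtain ⟨w, hw, hwJ⟩ := h3 {v₁, v₂, v₃} J (by
      simp only [Finset.coe_insert, Finset.coe_singleton]
      refine SimpleGraph.IsClique.insert ?_ ?_
      · simp [h23]
      · simp [hv₁₂, h13])
    (Finset.card_eq_three.2 ⟨v₁, v₂, v₃, hv₁₂.ne, h13.ne, h23.ne, rfl⟩) hJ (by
      simp only [Finset.disjoint_insert_left, Finset.disjoint_singleton_left]
      exact ⟨fun h => hv₁C (sJ h), fun h => hv₂C (sJ h), fun h => hv₃C (sJ h)⟩)
  obtain ⟨j, hj⟩ : J.Nonempty := Finset.card_pos.1 (by omega)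
  have hwC : w ∉ C := notC j (sJ hj) w (hwJ j hj)
  have indep : ∀ S ⊆ C, ∀ x ∈ S, ∀ y ∈ S, ¬ G.Adj x y := fun S hS x hx y hy =>
    hCC x (hS hx) y (hS hy)
  obtain ⟨i₁, hi₁, e₁⟩ := trace _ cI₁ (indep _ (sI₁.trans sC₁)) v₁ hv₁ w (hw v₁ (by simp))
    fun h => hwC (sC₁ (sI₁ h))
  obtain ⟨i₂, hi₂, e₂⟩ := trace _ cI₂ (indep _ (sI₂.trans sC₁)) v₂
    (by simpa [ho₂] using hv₂) w (hw v₂ (by simp)) fun h => hwC (sC₁ (sI₂ h))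
  obtain ⟨i₃, hi₃, e₃⟩ := trace _ cI₃ (indep _ (sI₃.trans sC₁)) v₃
    (by simpa [ha₃, hb₃] using hR₃') w (hw v₃ (by simp)) fun h => hwC (sC₁ (sI₃ h))
  have unique : ∀ x ∈ C₁, ∀ y ∈ C₁, G.Adj x w → G.Adj y w → x = y := by
    intro x hx y hy hxw hyw
    by_contra hxy
    refine hstar (insert x (insert y J)) (by simp [hxy, dJ hx, dJ hy, hJ]) (indep _ ?_) ⟨w, ?_⟩
    · simp [Finset.insert_subset_iff, sC₁ hx, sC₁ hy, sJ]
    · simpa [hxw, hyw] using hwJ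
  obtain rfl := unique i₁ (sI₁ hi₁) i₂ (sI₂ hi₂) e₁ e₂
  obtain rfl := unique i₁ (sI₁ hi₁) i₃ (sI₃ hi₃) e₁ e₃
  simp only [Finset.mem_insert] at hi₁ hi₂ hi₃
  grind

/-! ### Common neighbours of arbitrary finite sets -/

theorem exists_induced_path (h : ¬ IsCliqueUnion G) :
    ∃ a b c, G.Adj a b ∧ G.Adj b c ∧ a ≠ c ∧ ¬ G.Adj a c := by
  unfold IsCliqueUnion at h
  push Not at h
  exact h

/-- If some finite set has no common neighbour, then the independent sets with a common neighbour are
bounded in size by some `k`. A vertex then has at most `k` neighbours in a given independent set, so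
that large independent sets contain vertices isolated from any given finite set. This is
impossible by `not_forall_card_eq_exists_nbr`. -/
theorem TransfersCommonNbrs.hasCommonNbrs (hT : TransfersCommonNbrs G) (hG : ¬ IsCliqueUnion G)
    (hind : ∀ n, ∃ S : Finset V, S.card = n ∧ ∀ a ∈ S, ∀ b ∈ S, ¬ G.Adj a b) :
    HasCommonNbrs G := by
  classical
  have ofIndep : ∀ S S' : Finset V, S.card = S'.card → (∀ a ∈ S, ∀ b ∈ S, ¬ G.Adj a b) →
      (∃ v, ∀ a ∈ S, G.Adj a v) → ∃ w, ∀ a ∈ S', G.Adj a w := by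
    rintro S S' h hS ⟨v, hv⟩
    obtain ⟨w, -, -, hw⟩ := hT.cliques (K := ∅) (L := ∅) (Z := S) (K' := ∅) (L' := ∅) (Z' := S')
      (by simp) (by simp) (by simp) (by simp) (by simp) (by simp) (by simp) (by simp) (by simp) hS
      (by simp) (by simp) rfl rfl h ⟨v, by simp, by simp, hv⟩
    exact ⟨w, hw⟩
  by_contra hcon
  have hex : ∃ n, ∃ S : Finset V, S.card = n ∧ ¬ ∃ w, ∀ s ∈ S, G.Adj s w := by
    simp only [HasCommonNbrs, not_forall] at hcon
    obtain ⟨S, hS⟩ := hcon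
    exact ⟨_, S, rfl, hS⟩
  obtain ⟨S₀, hS₀, hS₀'⟩ := Nat.find_spec hex
  have hmin : ∀ S : Finset V, S.card < Nat.find hex → ∃ w, ∀ s ∈ S, G.Adj s w := by
    intro S hS
    by_contra h
    exact Nat.find_min hex hS ⟨S, rfl, h⟩
  obtain ⟨a, b, c, hab, hbc, hac, nac⟩ := exists_induced_path hG
  -- The endpoints of an induced path witness that any two vertices have a common neighbour.
  have h3 : 3 ≤ Nat.find hex := by
    by_contra hlt
    obtain ⟨S, hS, hSc⟩ : ∃ S : Finset V, S ⊆ {a, c} ∧ S.card = S₀.card :=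
      Finset.exists_subset_card_eq (by rw [Finset.card_pair hac]; omega)
    refine hS₀' (ofIndep S S₀ hSc ?_ ⟨b, ?_⟩)
    · intro x hx y hy
      have hx := hS hx
      have hy := hS hy
      simp only [Finset.mem_insert, Finset.mem_singleton] at hx hy
      rcases hx with rfl | rfl <;> rcases hy with rfl | rfl
      · exact G.irrefl
      · exact nac
      · exact fun h => nac h.symm
      · exact G.irrefl
    · intro x hx
      have hx := hS hx
      simp only [Finset.mem_insert, Finset.mem_singleton] at hx
      rcases hx with rfl | rfl
      · exact hab
      · exact hbc.symm
  obtain ⟨m, hm⟩ : ∃ m, Nat.find hex = m + 3 := ⟨Nat.find hex - 3, by omega⟩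
  have hstar : ∀ S : Finset V, S.card = m + 3 → (∀ a ∈ S, ∀ b ∈ S, ¬ G.Adj a b) →
      ¬ ∃ w, ∀ s ∈ S, G.Adj s w := fun S hS hS' h => hS₀' (ofIndep S S₀ (by omega) hS' h)
  refine not_forall_card_eq_exists_nbr hT (fun T => ?_) (fun S hS => hmin S (by omega)) hstar
  obtain ⟨C, hC, hCC⟩ := hind (T.card + T.card * (m + 2) + 1)
  have hlt : (T ∪ T.biUnion fun t => C.filter (G.Adj t)).card < C.card := by
    refine (Finset.card_union_le _ _).trans_lt ?_
    have : (T.biUnion fun t => C.filter (G.Adj t)).card ≤ T.card * (m + 2) := by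
      refine Finset.card_biUnion_le_card_mul _ _ _ fun t _ => ?_
      by_contra hgt
      obtain ⟨S, hS, hSc⟩ := Finset.exists_subset_card_eq
        (show m + 3 ≤ (C.filter (G.Adj t)).card by omega)
      exact hstar S hSc
        (fun x hx y hy => hCC x (Finset.mem_filter.1 (hS hx)).1 y (Finset.mem_filter.1 (hS hy)).1)
        ⟨t, fun s hs => (Finset.mem_filter.1 (hS hs)).2.symm⟩
    omega
  obtain ⟨v, hv, hv'⟩ := Finset.exists_mem_notMem_of_card_lt_card hlt
  simp only [Finset.mem_union, Finset.mem_biUnion, Finset.mem_filter, not_or, not_exists,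
    not_and] at hv'
  exact ⟨v, hv'.1, fun t ht => hv'.2 t ht hv⟩

/-- Ramsey's theorem for infinite vertex sets and finite homogeneous sets. -/
theorem exists_clique_or_indep (G : SimpleGraph V) (n m : ℕ) :
    ∀ X : Set V, X.Infinite →
      (∃ S : Finset V, ↑S ⊆ X ∧ S.card = n ∧ G.IsClique (S : Set V)) ∨
      ∃ S : Finset V, ↑S ⊆ X ∧ S.card = m ∧ Gᶜ.IsClique (S : Set V) := by
  classical
  induction n generalizing m with
  | zero => exact fun X _ => Or.inl ⟨∅, by simp⟩
  | succ n ihn =>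
    induction m with
    | zero => exact fun X _ => Or.inr ⟨∅, by simp⟩
    | succ m ihm =>
      intro X hX
      obtain ⟨x, hx⟩ := hX.nonempty
      have extend : ∀ (H : SimpleGraph V) (S : Finset V) (k : ℕ), (S : Set V) ⊆ {y ∈ X | H.Adj x y} →
          S.card = k → H.IsClique (S : Set V) → ((insert x S : Finset V) : Set V) ⊆ X ∧
            (insert x S).card = k + 1 ∧ H.IsClique ((insert x S : Finset V) : Set V) := by
        intro H S k hS hk hc
        refine ⟨?_, ?_, ?_⟩
        · rw [Finset.coe_insert]
          exact Set.insert_subset hx fun y hy => (hS hy).1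
        · rw [Finset.card_insert_of_notMem fun h => H.irrefl (hS h).2, hk]
        · rw [Finset.coe_insert]
          exact hc.insert fun y hy _ => (hS hy).2
      have hcover : X \ {x} ⊆ {y ∈ X | G.Adj x y} ∪ {y ∈ X | Gᶜ.Adj x y} := by
        rintro y ⟨hy, hyx⟩
        by_cases h : G.Adj x y
        · exact Or.inl ⟨hy, h⟩
        · exact Or.inr ⟨hy, (SimpleGraph.compl_adj _ _ _).2 ⟨fun e => hyx e.symm, h⟩⟩
      have hinf := (hX.sdiff (Set.finite_singleton x)).mono hcover
      rw [Set.infinite_union] at hinf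
      rcases hinf with h | h
      · rcases ihn (m + 1) _ h with ⟨S, h1, h2, h3⟩ | ⟨S, h1, h2, h3⟩
        · exact Or.inl ⟨insert x S, extend G S n h1 h2 h3⟩
        · exact Or.inr ⟨S, fun y hy => (h1 hy).1, h2, h3⟩
      · rcases ihm _ h with ⟨S, h1, h2, h3⟩ | ⟨S, h1, h2, h3⟩
        · exact Or.inl ⟨S, fun y hy => (h1 hy).1, h2, h3⟩
        · exact Or.inr ⟨insert x S, extend Gᶜ S m h1 h2 h3⟩

theorem HasCommonNbrs.exists_clique (h : HasCommonNbrs G) (n : ℕ) :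
    ∃ S : Finset V, S.card = n ∧ G.IsClique (S : Set V) := by
  classical
  induction n with
  | zero => exact ⟨∅, by simp⟩
  | succ n ih =>
    obtain ⟨S, hS, hc⟩ := ih
    obtain ⟨w, hw⟩ := h S
    refine ⟨insert w S, ?_, ?_⟩
    · rw [Finset.card_insert_of_notMem fun hwS => G.irrefl (hw w hwS), hS]
    · rw [Finset.coe_insert]
      exact hc.insert fun y hy _ => (hw y hy).symm

theorem not_adj_of_isClique_compl {S : Finset V} (h : Gᶜ.IsClique (S : Set V)) :
    ∀ a ∈ S, ∀ b ∈ S, ¬ G.Adj a b := fun _ ha _ hb hab =>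
  ((SimpleGraph.compl_adj _ _ _).1 (h ha hb hab.ne)).2 hab

theorem hasCommonNbrs_and_compl_of_indep (hT : TransfersCommonNbrs G)
    (hT' : TransfersCommonNbrs Gᶜ) (hG : ¬ IsCliqueUnion G) (hG' : ¬ IsCliqueUnion Gᶜ)
    (hind : ∀ n, ∃ S : Finset V, S.card = n ∧ Gᶜ.IsClique (S : Set V)) :
    HasCommonNbrs G ∧ HasCommonNbrs Gᶜ := by
  have h : HasCommonNbrs G := hT.hasCommonNbrs hG fun n => by
    obtain ⟨S, h1, h2⟩ := hind n
    exact ⟨S, h1, not_adj_of_isClique_compl h2⟩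
  refine ⟨h, hT'.hasCommonNbrs hG' fun n => ?_⟩
  obtain ⟨S, h1, h2⟩ := h.exists_clique n
  exact ⟨S, h1, not_adj_of_isClique_compl (by rwa [compl_compl])⟩

/-- Unless `G` or its complement is a disjoint union of cliques, both have common neighbours of
finite sets: one of the two has arbitrarily large independent sets by Ramsey's theorem, and common
neighbours in it then yield arbitrarily large independent sets of the other one. -/
theorem hasCommonNbrs_and_compl [Infinite V] (hT : TransfersCommonNbrs G)
    (hT' : TransfersCommonNbrs Gᶜ) (hG : ¬ IsCliqueUnion G) (hG' : ¬ IsCliqueUnion Gᶜ) :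
    HasCommonNbrs G ∧ HasCommonNbrs Gᶜ := by
  by_cases hind : ∀ n, ∃ S : Finset V, S.card = n ∧ Gᶜ.IsClique (S : Set V)
  · exact hasCommonNbrs_and_compl_of_indep hT hT' hG hG' hind
  · push Not at hind
    obtain ⟨m, hm⟩ := hind
    have := hasCommonNbrs_and_compl_of_indep (G := Gᶜ) hT' (by rwa [compl_compl]) hG'
      (by rwa [compl_compl]) (by
        intro n
        rw [compl_compl]
        rcases exists_clique_or_indep G n m Set.univ Set.infinite_univ with
          ⟨S, -, h⟩ | ⟨S, -, h1, h2⟩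
        · exact ⟨S, h⟩
        · exact (hm S h1 h2).elim)
    rw [compl_compl] at this
    exact this.symm

/-! ### Disjoint unions of cliques -/

theorem IsCliqueUnion.exists_not_adj (hG : IsCliqueUnion G) (hne : G ≠ ⊤) (a : V) :
    ∃ b, a ≠ b ∧ ¬ G.Adj a b := by
  by_contra! h
  refine hne (SimpleGraph.ext (funext fun x => funext fun y => propext ⟨fun e => e.ne, fun e => ?_⟩))
  by_cases hx : a = x
  · subst hx; exact h y e
  · by_cases hy : a = y
    · subst hy; exact (h x hx).symm
    · exact hG (h x hx).symm (h y hy) e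

/-- A disjoint union of cliques that is not complete has infinitely many components.

Otherwise take a finite set `T` with exactly one vertex in each component. Replacing one
element of `T` by a second vertex in the component of another one leaves a set that misses a
component, and mapping it back to `T` is a monomorphism of the complement. -/
theorem IsCliqueUnion.hasIsolatedVertices [Infinite V] (hG : IsCliqueUnion G) (hne : G ≠ ⊤)
    (hT : TransfersCommonNbrs G) (hT' : TransfersCommonNbrs Gᶜ) : HasIsolatedVertices G := by
  classical
  by_contra hcon
  simp only [HasIsolatedVertices, not_forall] at hcon
  have hex : ∃ n, ∃ T : Finset V, T.card = n ∧ ¬ ∃ v ∉ T, ∀ t ∈ T, ¬ G.Adj t v :=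
    let ⟨T, hT⟩ := hcon; ⟨_, T, rfl, hT⟩
  obtain ⟨T, hTc, hTn⟩ := Nat.find_spec hex
  have hmin : ∀ T : Finset V, T.card < Nat.find hex → ∃ v ∉ T, ∀ t ∈ T, ¬ G.Adj t v := by
    intro S hS
    by_contra h
    exact Nat.find_min hex hS ⟨S, rfl, h⟩
  -- The elements of `T` lie in different components.
  have hindep : ∀ t ∈ T, ∀ t' ∈ T, ¬ G.Adj t t' := by
    intro t ht t' ht' htt'
    obtain ⟨x, hx, hx'⟩ := hmin (T.erase t') (by
      rw [Finset.card_erase_of_mem ht', ← hTc]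
      exact Nat.pred_lt (Finset.card_pos.2 ⟨t', ht'⟩).ne')
    have htm : t ∈ T.erase t' := Finset.mem_erase.2 ⟨htt'.ne, ht⟩
    have hxt : t ≠ x := fun h => hx (h ▸ htm)
    have hxt' : ¬ G.Adj t' x := fun h => hx' t htm (hG htt' h hxt)
    have hxne : x ≠ t' := fun h => hx' t htm (h ▸ htt')
    refine hTn ⟨x, fun h => hx (Finset.mem_erase.2 ⟨hxne, h⟩), fun s hs => ?_⟩
    by_cases hst : s = t'
    · subst hst; exact hxt'
    · exact hx' s (Finset.mem_erase.2 ⟨hst, hs⟩)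
  have h2 : 1 < T.card := by
    by_contra hle
    rcases Finset.card_le_one_iff_subset_singleton.1 (not_lt.1 hle) with ⟨x, hx⟩
    obtain ⟨y, hxy, hadj⟩ := hG.exists_not_adj hne x
    refine hTn ⟨y, fun h => hxy (Finset.mem_singleton.1 (hx h)).symm, fun t ht => ?_⟩
    rw [Finset.mem_singleton.1 (hx ht)]
    exact hadj
  obtain ⟨t₁, ht₁, t₂, ht₂, h12⟩ := Finset.one_lt_card.1 h2
  -- Some vertex has a neighbour, as all vertices outside `T` are adjacent to elements of `T`;
  -- by transfer of common neighbours, `t₁` has one too.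
  obtain ⟨d, hd⟩ : ∃ d, G.Adj t₁ d := by
    obtain ⟨x, hx⟩ := Infinite.exists_notMem_finset T
    obtain ⟨t, ht, htx⟩ : ∃ t ∈ T, G.Adj t x := by
      by_contra! h
      exact hTn ⟨x, hx, h⟩
    obtain ⟨w, hw⟩ := hT {t} (Set.finite_singleton t) (fun _ => t₁) (by simp) (by simp)
      ⟨x, by simpa using htx⟩
    exact ⟨w, hw t rfl⟩
  have hdT : d ∉ T := fun h => hindep t₁ ht₁ d h hd
  have hd2 : ¬ G.Adj d t₂ := fun h => hindep t₁ ht₁ t₂ ht₂ (hG hd h h12)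
  have hf : ∀ x ∈ T.erase t₂, (if x = d then t₂ else x) = x := fun x hx =>
    if_neg fun h : x = d => hdT (h ▸ Finset.mem_of_mem_erase hx)
  obtain ⟨w, hw⟩ := hT' (insert d (T.erase t₂) : Finset V) (Finset.finite_toSet _)
    (fun x => if x = d then t₂ else x)
    (by
      intro x hx y hy e
      rcases Finset.mem_insert.1 hx with rfl | hx' <;>
        rcases Finset.mem_insert.1 hy with rfl | hy'
      · rfl
      · simp only [if_true, hf y hy'] at e
        exact ((Finset.mem_erase.1 hy').1 e.symm).elim
      · simp only [if_true, hf x hx'] at e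
        exact ((Finset.mem_erase.1 hx').1 e).elim
      · simpa only [hf x hx', hf y hy'] using e)
    (by
      intro x hx y hy e
      rcases Finset.mem_insert.1 hx with rfl | hx' <;>
        rcases Finset.mem_insert.1 hy with rfl | hy'
      · exact (e.ne rfl).elim
      · simp only [if_true, hf y hy', SimpleGraph.compl_adj]
        exact ⟨(Finset.mem_erase.1 hy').1.symm, hindep _ ht₂ _ (Finset.mem_of_mem_erase hy')⟩
      · simp only [if_true, hf x hx', SimpleGraph.compl_adj]
        exact ⟨(Finset.mem_erase.1 hx').1, hindep _ (Finset.mem_of_mem_erase hx') _ ht₂⟩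
      · simpa only [hf x hx', hf y hy'] using e)
    ⟨t₂, by
      intro x hx
      rw [SimpleGraph.compl_adj]
      rcases Finset.mem_insert.1 hx with rfl | hx
      · exact ⟨fun h => hdT (h ▸ ht₂), hd2⟩
      · exact ⟨(Finset.mem_erase.1 hx).1, hindep _ (Finset.mem_of_mem_erase hx) _ ht₂⟩⟩
  have hw' : ∀ t ∈ T, Gᶜ.Adj t w := by
    intro t ht
    by_cases h : t = t₂
    · subst h
      simpa using hw d (by simp)
    · have hm := Finset.mem_erase.2 ⟨h, ht⟩
      simpa only [hf t hm] using hw t (Finset.mem_coe.2 (Finset.mem_insert_of_mem hm))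
  exact hTn ⟨w, fun h => (hw' w h).ne rfl, fun t ht => ((SimpleGraph.compl_adj _ _ _).1 (hw' t ht)).2⟩

/-! ### Back and forth -/

/-- A set of pairs that is the graph of a homomorphism between induced subgraphs. -/
def IsPartialHom (G : SimpleGraph V) (R : Finset (V × V)) : Prop :=
  ∀ p ∈ R, ∀ q ∈ R, (p.1 = q.1 → p.2 = q.2) ∧ (G.Adj p.1 q.1 → G.Adj p.2 q.2)

/-- Every finite partial homomorphism extends to each new vertex of the domain, with a new value. -/
def ExtendsForth (G : SimpleGraph V) : Prop :=
  ∀ R : Finset (V × V), IsPartialHom G R → ∀ v, (∀ p ∈ R, p.1 ≠ v) →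
    ∃ w, (∀ p ∈ R, p.2 ≠ w) ∧ ∀ p ∈ R, G.Adj p.1 v → G.Adj p.2 w

/-- Every finite partial homomorphism extends to attain each new value, at a new vertex of the
domain. -/
def ExtendsBack (G : SimpleGraph V) : Prop :=
  ∀ R : Finset (V × V), IsPartialHom G R → ∀ w, (∀ p ∈ R, p.2 ≠ w) →
    ∃ v, (∀ p ∈ R, p.1 ≠ v) ∧ ∀ p ∈ R, G.Adj p.1 v → G.Adj p.2 w

/-- Back and forth for finite relations whose pairs satisfy a binary condition `Q`. -/
theorem exists_total_surjective_relation [Countable V] (Q : V × V → V × V → Prop)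
    (forth : ∀ R : Finset (V × V), (∀ p ∈ R, ∀ q ∈ R, Q p q) → ∀ v, ∃ w,
      ∃ R' : Finset (V × V), R ⊆ R' ∧ (v, w) ∈ R' ∧ ∀ p ∈ R', ∀ q ∈ R', Q p q)
    (back : ∀ R : Finset (V × V), (∀ p ∈ R, ∀ q ∈ R, Q p q) → ∀ w, ∃ v,
      ∃ R' : Finset (V × V), R ⊆ R' ∧ (v, w) ∈ R' ∧ ∀ p ∈ R', ∀ q ∈ R', Q p q)
    (R : Finset (V × V)) (hR : ∀ p ∈ R, ∀ q ∈ R, Q p q) :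
    ∃ U : Set (V × V), ↑R ⊆ U ∧ (∀ p ∈ U, ∀ q ∈ U, Q p q) ∧ (∀ v, ∃ w, (v, w) ∈ U) ∧
      ∀ w, ∃ v, (v, w) ∈ U := by
  let P := {R : Finset (V × V) // ∀ p ∈ R, ∀ q ∈ R, Q p q}
  have : Encodable V := Encodable.ofCountable V
  let D : V ⊕ V → Order.Cofinal P := Sum.elim
    (fun v => ⟨{R | ∃ w, (v, w) ∈ R.1}, fun R =>
      let ⟨w, R', h1, h2, h3⟩ := forth R.1 R.2 v
      ⟨⟨R', h3⟩, ⟨w, h2⟩, h1⟩⟩)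
    (fun w => ⟨{R | ∃ v, (v, w) ∈ R.1}, fun R =>
      let ⟨v, R', h1, h2, h3⟩ := back R.1 R.2 w
      ⟨⟨R', h3⟩, ⟨v, h2⟩, h1⟩⟩)
  let I := Order.idealOfCofinals (⟨R, hR⟩ : P) D
  refine ⟨{p | ∃ S ∈ I, p ∈ S.1}, ?_, ?_, ?_, ?_⟩
  · exact fun p hp => ⟨⟨R, hR⟩, Order.mem_idealOfCofinals _ _, hp⟩
  · rintro p ⟨S, hS, hp⟩ q ⟨S', hS', hq⟩
    obtain ⟨S'', -, h1, h2⟩ := I.directed S hS S' hS'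
    exact S''.2 p (h1 hp) q (h2 hq)
  · intro v
    obtain ⟨S, ⟨w, hw⟩, hS⟩ := Order.cofinal_meets_idealOfCofinals (⟨R, hR⟩ : P) D (.inl v)
    exact ⟨w, S, hS, hw⟩
  · intro w
    obtain ⟨S, ⟨v, hv⟩, hS⟩ := Order.cofinal_meets_idealOfCofinals (⟨R, hR⟩ : P) D (.inr w)
    exact ⟨v, S, hS, hv⟩

theorem IsPartialHom.insert [DecidableEq V] {R : Finset (V × V)} (hR : IsPartialHom G R) {v w : V}
    (hv : ∀ p ∈ R, p.1 ≠ v) (hw : ∀ p ∈ R, G.Adj p.1 v → G.Adj p.2 w) :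
    IsPartialHom G (insert (v, w) R) := by
  intro p hp q hq
  rcases Finset.mem_insert.1 hp with rfl | hp' <;> rcases Finset.mem_insert.1 hq with rfl | hq'
  · exact ⟨fun _ => rfl, fun h => (G.irrefl h).elim⟩
  · exact ⟨fun h => (hv q hq' h.symm).elim, fun h => (hw q hq' h.symm).symm⟩
  · exact ⟨fun h => (hv p hp' h).elim, fun h => hw p hp' h⟩
  · exact hR p hp' q hq'

/-- Common neighbours transfer along all homomorphisms, as an arbitrary section of a homomorphism
is a monomorphism in the other direction. -/
theorem TransfersCommonNbrs.exists_extension (hT : TransfersCommonNbrs G) {R : Finset (V × V)}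
    (hR : IsPartialHom G R) (v : V) : ∃ w, ∀ p ∈ R, G.Adj p.1 v → G.Adj p.2 w := by
  have hx : ∀ t : {t | ∃ p ∈ R, G.Adj p.1 v ∧ p.2 = t}, ∃ p ∈ R, G.Adj p.1 v ∧ p.2 = t.1 :=
    fun t => t.2
  choose x hxR hxv hx2 using hx
  have : Finite {t | ∃ p ∈ R, G.Adj p.1 v ∧ p.2 = t} :=
    (R.finite_toSet.image Prod.snd).subset fun t ⟨p, hp, _, e⟩ => ⟨p, hp, e⟩
  obtain ⟨w, hw⟩ := hT.family (x := fun t => (x t).1) (y := fun t => t.1)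
    (fun t t' e => Subtype.ext (by
      rw [← hx2 t, ← hx2 t']
      exact (hR _ (hxR t) _ (hxR t')).1 e))
    Subtype.val_injective
    (fun t t' e => by
      rw [← hx2 t, ← hx2 t']
      exact (hR _ (hxR t) _ (hxR t')).2 e)
    ⟨v, hxv⟩
  exact ⟨w, fun p hp hpv => hw ⟨p.2, p, hp, hpv, rfl⟩⟩

theorem isHEHomogeneous_of_extendsBack [Countable V] (hT : TransfersCommonNbrs G)
    (hB : ExtendsBack G) : IsHEHomogeneous G := by
  classical
  intro A B hA _ f
  have := hA.to_subtype
  obtain ⟨U, hU, hQ, h1, h2⟩ := exists_total_surjective_relation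
    (fun p q : V × V => (p.1 = q.1 → p.2 = q.2) ∧ (G.Adj p.1 q.1 → G.Adj p.2 q.2))
    (by
      intro R hR v
      by_cases hv : ∃ p ∈ R, p.1 = v
      · obtain ⟨p, hp, rfl⟩ := hv
        exact ⟨p.2, R, subset_rfl, hp, hR⟩
      · push Not at hv
        obtain ⟨w, hw⟩ := hT.exists_extension hR v
        exact ⟨w, insert (v, w) R, Finset.subset_insert _ _, Finset.mem_insert_self _ _,
          IsPartialHom.insert hR hv hw⟩)
    (by
      intro R hR w
      by_cases hw : ∃ p ∈ R, p.2 = w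
      · obtain ⟨p, hp, rfl⟩ := hw
        exact ⟨p.1, R, subset_rfl, hp, hR⟩
      · push Not at hw
        obtain ⟨v, hv, hvw⟩ := hB R hR w hw
        exact ⟨v, insert (v, w) R, Finset.subset_insert _ _, Finset.mem_insert_self _ _,
          IsPartialHom.insert hR hv hvw⟩)
    (Set.finite_range fun a : A => ((a : V), (f a : V))).toFinset
    (by
      simp only [Set.Finite.mem_toFinset, Set.mem_range]
      rintro _ ⟨a, rfl⟩ _ ⟨b, rfl⟩
      exact ⟨fun h => congrArg (fun x => (f x : V)) (Subtype.ext h), fun h => f.map_adj h⟩)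
  choose F hF using h1
  refine ⟨⟨F, fun {a b} h => (hQ _ (hF a) _ (hF b)).2 h⟩, fun w => ?_, fun a => ?_⟩
  · obtain ⟨v, hv⟩ := h2 w
    exact ⟨v, (hQ _ (hF v) _ hv).1 rfl⟩
  · exact (hQ _ (hF a) ((a : V), (f a : V)) (hU (by simp))).1 rfl

theorem isMBHomogeneous_of_extends [Countable V] (hF : ExtendsForth G) (hB : ExtendsBack G) :
    IsMBHomogeneous G := by
  classical
  intro A B hA _ f hf
  have := hA.to_subtype
  have insert_inj : ∀ {R : Finset (V × V)} {v w : V}, (∀ p ∈ R, ∀ q ∈ R, p.2 = q.2 → p.1 = q.1) →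
      (∀ p ∈ R, p.2 ≠ w) → ∀ p ∈ insert (v, w) R, ∀ q ∈ insert (v, w) R, p.2 = q.2 → p.1 = q.1 := by
    intro R v w hR hw p hp q hq
    rcases Finset.mem_insert.1 hp with rfl | hp' <;> rcases Finset.mem_insert.1 hq with rfl | hq'
    · exact fun _ => rfl
    · exact fun h => (hw q hq' h.symm).elim
    · exact fun h => (hw p hp' h).elim
    · exact hR p hp' q hq'
  obtain ⟨U, hU, hQ, h1, h2⟩ := exists_total_surjective_relation
    (fun p q : V × V => ((p.1 = q.1 → p.2 = q.2) ∧ (G.Adj p.1 q.1 → G.Adj p.2 q.2)) ∧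
      (p.2 = q.2 → p.1 = q.1))
    (by
      intro R hR v
      by_cases hv : ∃ p ∈ R, p.1 = v
      · obtain ⟨p, hp, rfl⟩ := hv
        exact ⟨p.2, R, subset_rfl, hp, hR⟩
      · push Not at hv
        have hR1 : IsPartialHom G R := fun p hp q hq => (hR p hp q hq).1
        obtain ⟨w, hw, hvw⟩ := hF R hR1 v hv
        exact ⟨w, insert (v, w) R, Finset.subset_insert _ _, Finset.mem_insert_self _ _,
          fun p hp q hq => ⟨hR1.insert hv hvw p hp q hq,
            insert_inj (fun p hp q hq => (hR p hp q hq).2) hw p hp q hq⟩⟩)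
    (by
      intro R hR w
      by_cases hw : ∃ p ∈ R, p.2 = w
      · obtain ⟨p, hp, rfl⟩ := hw
        exact ⟨p.1, R, subset_rfl, hp, hR⟩
      · push Not at hw
        have hR1 : IsPartialHom G R := fun p hp q hq => (hR p hp q hq).1
        obtain ⟨v, hv, hvw⟩ := hB R hR1 w hw
        exact ⟨v, insert (v, w) R, Finset.subset_insert _ _, Finset.mem_insert_self _ _,
          fun p hp q hq => ⟨hR1.insert hv hvw p hp q hq,
            insert_inj (fun p hp q hq => (hR p hp q hq).2) hw p hp q hq⟩⟩)
    (Set.finite_range fun a : A => ((a : V), (f a : V))).toFinset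
    (by
      simp only [Set.Finite.mem_toFinset, Set.mem_range]
      rintro _ ⟨a, rfl⟩ _ ⟨b, rfl⟩
      exact ⟨⟨fun h => congrArg (fun x => (f x : V)) (Subtype.ext h), fun h => f.map_adj h⟩,
        fun h => congrArg Subtype.val (hf (Subtype.ext h))⟩)
  choose F hF using h1
  refine ⟨⟨F, fun {a b} h => (hQ _ (hF a) _ (hF b)).1.2 h⟩,
    ⟨fun a b h => (hQ _ (hF a) _ (hF b)).2 h, fun w => ?_⟩, fun a => ?_⟩
  · obtain ⟨v, hv⟩ := h2 w
    exact ⟨v, (hQ _ (hF v) _ hv).1.1 rfl⟩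
  · exact (hQ _ (hF a) ((a : V), (f a : V)) (hU (by simp))).1.1 rfl

theorem HasCommonNbrs.extendsForth (h : HasCommonNbrs G) : ExtendsForth G := by
  classical
  intro R _ v _
  obtain ⟨w, hw⟩ := h (R.image Prod.snd)
  have hw' : ∀ p ∈ R, G.Adj p.2 w := fun p hp => hw _ (Finset.mem_image_of_mem _ hp)
  exact ⟨w, fun p hp => (hw' p hp).ne, fun p hp _ => hw' p hp⟩

theorem HasIsolatedVertices.extendsBack (h : HasIsolatedVertices G) : ExtendsBack G := by
  classical
  intro R _ w _
  obtain ⟨v, hv, hv'⟩ := h (R.image Prod.fst)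
  exact ⟨v, fun p hp e => hv (e ▸ Finset.mem_image_of_mem _ hp),
    fun p hp e => (hv' _ (Finset.mem_image_of_mem _ hp) e).elim⟩

/-! ### Consequences of ME-homogeneity -/

theorem IsMEHomogeneous.exists_hom (h : IsMEHomogeneous G) {s : Set V} (hs : s.Finite) {f : V → V}
    (hf : Set.InjOn f s) (hadj : ∀ a ∈ s, ∀ b ∈ s, G.Adj a b → G.Adj (f a) (f b)) :
    ∃ F : G →g G, Function.Surjective F ∧ ∀ a ∈ s, F a = f a := by
  obtain ⟨F, hF, hFa⟩ := h s (f '' s) hs (hs.image f)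
    ⟨fun a => ⟨f a, a, a.2, rfl⟩, fun {a b} e => hadj a a.2 b b.2 e⟩
    (fun a b e => Subtype.ext (hf a.2 b.2 (congrArg Subtype.val e)))
  exact ⟨F, hF, fun a ha => hFa ⟨a, ha⟩⟩

theorem IsMEHomogeneous.transfersCommonNbrs (h : IsMEHomogeneous G) : TransfersCommonNbrs G := by
  rintro s hs f hf hadj ⟨v, hv⟩
  obtain ⟨F, -, hFa⟩ := h.exists_hom hs hf hadj
  exact ⟨F v, fun a ha => hFa a ha ▸ F.map_adj (hv a ha)⟩

/-- The inverse of a monomorphism of the complement is a monomorphism of the graph, and a preimage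
of `v` under an epimorphism extending it is as required. -/
theorem IsMEHomogeneous.transfersCommonNbrs_compl (h : IsMEHomogeneous G) :
    TransfersCommonNbrs Gᶜ := by
  rintro s hs f hf hadj ⟨v, hv⟩
  have : Nonempty V := ⟨v⟩
  have hinv : ∀ a ∈ s, Function.invFunOn f s (f a) = a := hf.leftInvOn_invFunOn
  obtain ⟨F, hF, hFa⟩ := h.exists_hom (hs.image f) (f := Function.invFunOn f s)
    (by
      rintro _ ⟨a, ha, rfl⟩ _ ⟨b, hb, rfl⟩ e
      rw [hinv a ha, hinv b hb] at e
      rw [e])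
    (by
      rintro _ ⟨a, ha, rfl⟩ _ ⟨b, hb, rfl⟩ e
      rw [hinv a ha, hinv b hb]
      by_contra hn
      refine ((SimpleGraph.compl_adj _ _ _).1 (hadj a ha b hb ?_)).2 e
      exact (SimpleGraph.compl_adj _ _ _).2 ⟨fun h => e.ne (h ▸ rfl), hn⟩)
  obtain ⟨w, rfl⟩ := hF v
  refine ⟨w, fun a ha => ?_⟩
  have e : F (f a) = a := (hFa _ ⟨a, ha, rfl⟩).trans (hinv a ha)
  have hva := (SimpleGraph.compl_adj _ _ _).1 (hv a ha)
  rw [SimpleGraph.compl_adj]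
  refine ⟨fun hw => hva.1 (by rw [← hw, e]), fun hw => hva.2 ?_⟩
  have := F.map_adj hw
  rwa [e] at this

/-! ### Unions of cliques and complete multipartite graphs -/

theorem IsCliqueUnion.extendsForth [Infinite V] (hG : IsCliqueUnion G)
    (hT : TransfersCommonNbrs G) (hinf : ∀ v x, G.Adj v x → (G.neighborSet v).Infinite) :
    ExtendsForth G := by
  classical
  intro R hR v hv
  by_cases h : ∃ p ∈ R, G.Adj p.1 v
  · obtain ⟨p, hp, hpv⟩ := h
    obtain ⟨x, hx⟩ := hT.exists_extension hR v
    obtain ⟨w, hw, hwR⟩ := (hinf _ _ (hx p hp hpv)).exists_notMem_finset (R.image Prod.snd)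
    have hwR' : ∀ q ∈ R, q.2 ≠ w := fun q hq e => hwR (e ▸ Finset.mem_image_of_mem _ hq)
    refine ⟨w, hwR', fun q hq hqv => ?_⟩
    by_cases hqp : q.1 = p.1
    · rw [(hR q hq p hp).1 hqp]
      exact hw
    · exact hG ((hR q hq p hp).2 (hG hqv hpv.symm hqp)) hw (hwR' q hq)
  · push Not at h
    obtain ⟨w, hwR⟩ := Infinite.exists_notMem_finset (R.image Prod.snd)
    exact ⟨w, fun q hq e => hwR (e ▸ Finset.mem_image_of_mem _ hq),
      fun q hq hqv => (h q hq hqv).elim⟩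

/-- If `p` is a pair whose value lies in the class of `w`, then all arguments whose value lies in
this class are in the class of `p.1`; so any new element of that class may be sent to `w`. -/
theorem IsCliqueUnion.extendsBack_of_compl [Infinite V] (hG : IsCliqueUnion Gᶜ)
    (hT : TransfersCommonNbrs Gᶜ) (hinf : ∀ v x, Gᶜ.Adj v x → (Gᶜ.neighborSet v).Infinite) :
    ExtendsBack G := by
  classical
  intro R hR w hw
  have hw' : ∀ q ∈ R, ¬ Gᶜ.Adj q.2 w → G.Adj q.2 w := by
    intro q hq h
    by_contra hn
    exact h ((SimpleGraph.compl_adj _ _ _).2 ⟨hw q hq, hn⟩)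
  by_cases h : ∃ p ∈ R, Gᶜ.Adj p.2 w
  · obtain ⟨p, hp, hpw⟩ := h
    obtain ⟨x, hx⟩ := hT {p.2} (Set.finite_singleton _) (fun _ => p.1) (by simp) (by simp)
      ⟨w, by simpa using hpw⟩
    obtain ⟨v, hpv, hvR⟩ := (hinf _ _ (hx p.2 rfl)).exists_notMem_finset (R.image Prod.fst)
    have hvR' : ∀ q ∈ R, q.1 ≠ v := fun q hq e => hvR (e ▸ Finset.mem_image_of_mem _ hq)
    refine ⟨v, hvR', fun q hq hqv => hw' q hq fun hqw => ?_⟩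
    have hqp : ¬ G.Adj q.1 p.1 := by
      intro hadj
      have h2 := (hR q hq p hp).2 hadj
      exact ((SimpleGraph.compl_adj _ _ _).1 (hG hqw hpw.symm h2.ne)).2 h2
    by_cases e : q.1 = p.1
    · rw [e] at hqv
      exact ((SimpleGraph.compl_adj _ _ _).1 hpv).2 hqv
    · exact ((SimpleGraph.compl_adj _ _ _).1
        (hG ((SimpleGraph.compl_adj _ _ _).2 ⟨e, hqp⟩) hpv (hvR' q hq))).2 hqv
  · push Not at h
    obtain ⟨v, hvR⟩ := Infinite.exists_notMem_finset (R.image Prod.fst)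
    exact ⟨v, fun q hq e => hvR (e ▸ Finset.mem_image_of_mem _ hq),
      fun q hq _ => hw' q hq (h q hq)⟩

/-- In an ME-homogeneous complete multipartite graph the nontrivial parts are infinite: an
epimorphism that fixes `a` and moves another element of the part of `a` out of this part must map
the rest of the part onto a set containing the whole part. -/
theorem IsMEHomogeneous.infinite_part (h : IsMEHomogeneous G) (hG : IsCliqueUnion Gᶜ)
    (hne : Gᶜ ≠ ⊤) {a c : V} (hac : Gᶜ.Adj a c) : (Gᶜ.neighborSet a).Infinite := by
  classical
  intro hfin
  obtain ⟨b, hab, hab'⟩ := hG.exists_not_adj hne a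
  have hadj : G.Adj a b := by
    by_contra hn
    exact hab' ((SimpleGraph.compl_adj _ _ _).2 ⟨hab, hn⟩)
  have hac' := (SimpleGraph.compl_adj _ _ _).1 hac
  obtain ⟨F, hF, hFa⟩ := h.exists_hom (s := {a, c}) (by simp) (f := fun x => if x = c then b else x)
    (by
      rintro x (rfl | rfl) y (rfl | rfl) e
      · rfl
      · simp only [if_true, if_neg hac'.1] at e
        exact (hab e).elim
      · simp only [if_true, if_neg hac'.1] at e
        exact (hab e.symm).elim
      · rfl)
    (by
      rintro x (rfl | rfl) y (rfl | rfl) e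
      · exact (e.ne rfl).elim
      · exact (hac'.2 e).elim
      · exact (hac'.2 e.symm).elim
      · exact (e.ne rfl).elim)
  have Fa : F a = a := by rw [hFa a (by simp), if_neg hac'.1]
  have Fc : F c = b := by rw [hFa c (by simp), if_pos rfl]
  set C := insert a (Gᶜ.neighborSet a) with hC
  have hCfin : C.Finite := hfin.insert a
  have memC : ∀ x, x ∈ C ↔ ¬ G.Adj a x := by
    intro x
    rw [hC, Set.mem_insert_iff, SimpleGraph.mem_neighborSet, SimpleGraph.compl_adj]
    constructor
    · rintro (rfl | h)
      · exact G.irrefl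
      · exact h.2
    · intro h
      by_cases e : x = a
      · exact Or.inl e
      · exact Or.inr ⟨Ne.symm e, h⟩
  have hsub : C ⊆ F '' (C \ {c}) := by
    intro y hy
    obtain ⟨x, rfl⟩ := hF y
    rw [memC] at hy
    refine ⟨x, ⟨(memC x).2 fun hx => hy ?_, fun hx => hy ?_⟩, rfl⟩
    · have := F.map_adj hx
      rwa [Fa] at this
    · rw [Set.mem_singleton_iff.1 hx, Fc]
      exact hadj
  have h1 := Set.ncard_le_ncard hsub ((hCfin.sdiff).image F)
  have h2 := Set.ncard_image_le (f := F) (hCfin.sdiff (t := {c}))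
  have h3 := Set.ncard_sdiff_singleton_lt_of_mem ((memC c).2 hac'.2) hCfin
  omega

/-! ### Disjoint unions of finite cliques of equal size -/

theorem cliqueCopies_adj {n : ℕ} {x y : ℕ × Fin n} :
    (cliqueCopies n).Adj x y ↔ x.1 = y.1 ∧ x ≠ y := by
  simp only [cliqueCopies, lexProd, SimpleGraph.bot_adj, SimpleGraph.top_adj, false_or]
  constructor
  · rintro ⟨h, h'⟩
    exact ⟨h, fun e => h' (congrArg Prod.snd e)⟩
  · rintro ⟨h, h'⟩
    exact ⟨h, fun e => h' (Prod.ext h e)⟩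

/-- An endomorphism is injective on cliques, so one that maps `t` to `t'` witnesses that the degree
of `t` is at most that of `t'`. -/
theorem IsMEHomogeneous.encard_neighborSet_le (h : IsMEHomogeneous G) (hG : IsCliqueUnion G)
    (t t' : V) : (G.neighborSet t).encard ≤ (G.neighborSet t').encard := by
  obtain ⟨F, -, hF⟩ := h.exists_hom (s := {t}) (by simp) (f := fun _ => t') (by simp) (by simp)
  have hFt : F t = t' := hF t rfl
  have hinj : Set.InjOn F (G.neighborSet t) := by
    intro x hx y hy e
    by_contra hxy
    exact (F.map_adj (hG (SimpleGraph.Adj.symm hx) hy hxy)).ne e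
  rw [← hinj.encard_image]
  refine Set.encard_le_encard ?_
  rintro _ ⟨x, hx, rfl⟩
  rw [SimpleGraph.mem_neighborSet, ← hFt]
  exact F.map_adj hx

theorem IsCliqueUnion.nonempty_iso_cliqueCopies [Countable V] [Infinite V] (hG : IsCliqueUnion G)
    {d : ℕ} (hd : ∀ v, (G.neighborSet v).encard = d) : Nonempty (G ≃g cliqueCopies (d + 1)) := by
  let r : Setoid V :=
    ⟨fun a b => a = b ∨ G.Adj a b, fun a => Or.inl rfl, by
      rintro a b (rfl | h)
      · exact Or.inl rfl
      · exact Or.inr h.symm, by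
      rintro a b c (rfl | h) (rfl | h')
      · exact Or.inl rfl
      · exact Or.inr h'
      · exact Or.inr h
      · by_cases e : a = c
        · exact Or.inl e
        · exact Or.inr (hG h h' e)⟩
  have hr : ∀ a b : V, Quotient.mk r a = Quotient.mk r b ↔ a = b ∨ G.Adj a b := fun a b =>
    Quotient.eq (r := r)
  have hfib : ∀ q : Quotient r, Nonempty ({b // Quotient.mk r b = q} ≃ Fin (d + 1)) := by
    intro q
    induction q using Quotient.inductionOn with
    | h t =>
      have hset : {b | Quotient.mk r b = Quotient.mk r t} = insert t (G.neighborSet t) := by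
        ext b
        rw [Set.mem_ofPred_eq, hr, Set.mem_insert_iff, SimpleGraph.mem_neighborSet,
          SimpleGraph.adj_comm]
      have hcard : {b | Quotient.mk r b = Quotient.mk r t}.encard = (d + 1 : ℕ) := by
        rw [hset, Set.encard_insert_of_notMem (by simp), hd t]
        rfl
      have : Finite {b // Quotient.mk r b = Quotient.mk r t} :=
        Set.finite_of_encard_eq_coe hcard
      refine ⟨Finite.equivFinOfCardEq ?_⟩
      exact (Nat.card_coe_set_eq _).trans (congrArg ENat.toNat hcard)
  let e : V ≃ Quotient r × Fin (d + 1) :=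
    (Equiv.sigmaFiberEquiv (Quotient.mk r)).symm.trans
      (Equiv.sigmaEquivProdOfEquiv fun q => (hfib q).some)
  have he : ∀ x, (e x).1 = Quotient.mk r x := fun x => rfl
  have : Infinite (Quotient r) := by
    by_contra hfin
    rw [not_infinite_iff_finite] at hfin
    have := Finite.of_equiv _ e.symm
    exact not_finite V
  have : Countable (Quotient r) := Quotient.mk_surjective.countable
  obtain ⟨i⟩ := nonempty_denumerable (Quotient r)
  let e' : V ≃ ℕ × Fin (d + 1) := e.trans ((Denumerable.eqv (Quotient r)).prodCongr (Equiv.refl _))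
  refine ⟨⟨e', fun {x y} => ?_⟩⟩
  rw [cliqueCopies_adj, e'.injective.ne_iff]
  have : (e' x).1 = (e' y).1 ↔ x = y ∨ G.Adj x y := by
    rw [← hr, ← he, ← he]
    exact (Denumerable.eqv (Quotient r)).injective.eq_iff
  rw [this]
  constructor
  · rintro ⟨h | h, h'⟩
    · exact (h' h).elim
    · exact h
  · exact fun h => ⟨Or.inr h, h.ne⟩

theorem transfersCommonNbrs_of_iso {n : ℕ} (e : G ≃g cliqueCopies n) : TransfersCommonNbrs G := by
  have hadj : ∀ x y, G.Adj x y ↔ (e x).1 = (e y).1 ∧ x ≠ y := fun x y => by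
    rw [← e.map_adj_iff, cliqueCopies_adj, e.injective.ne_iff]
  rintro s hs f hf hfadj ⟨v, hv⟩
  rcases s.eq_empty_or_nonempty with rfl | ⟨a, ha⟩
  · exact ⟨v, by simp⟩
  have same : ∀ x ∈ s, (e x).1 = (e v).1 := fun x hx => ((hadj _ _).1 (hv x hx)).1
  have hf1 : ∀ x ∈ s, (e (f x)).1 = (e (f a)).1 := by
    intro x hx
    by_cases hxa : x = a
    · rw [hxa]
    · exact ((hadj _ _).1 (hfadj x hx a ha
        ((hadj _ _).2 ⟨(same x hx).trans (same a ha).symm, hxa⟩))).1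
  -- `s` misses an element of its component, hence so does its image.
  obtain ⟨j, hj⟩ : ∃ j, j ∉ (fun x => (e (f x)).2) '' s := by
    by_contra! hall
    have h1 : (Set.univ : Set (Fin n)).ncard ≤ s.ncard :=
      (Set.ncard_le_ncard (fun j _ => hall j) (hs.image _)).trans (Set.ncard_image_le hs)
    have hinj : Set.InjOn (fun x => (e x).2) s := fun x hx y hy h =>
      e.injective (Prod.ext ((same x hx).trans (same y hy).symm) h)
    have hmiss : (e v).2 ∉ (fun x => (e x).2) '' s := by
      rintro ⟨x, hx, h⟩
      exact (hv x hx).ne (e.injective (Prod.ext (same x hx) h))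
    have h2 : ((fun x => (e x).2) '' s).ncard < (Set.univ : Set (Fin n)).ncard :=
      Set.ncard_lt_ncard (Set.ssubset_univ_iff.2 fun h => hmiss (by rw [h]; trivial)) Set.finite_univ
    rw [hinj.ncard_image] at h2
    omega
  refine ⟨e.symm ((e (f a)).1, j), fun x hx => (hadj _ _).2 ⟨?_, ?_⟩⟩
  · simpa using hf1 x hx
  · intro h
    exact hj ⟨x, hx, by simp [h]⟩

theorem hasIsolatedVertices_of_iso {n : ℕ} (hn : 2 ≤ n) (e : G ≃g cliqueCopies n) :
    HasIsolatedVertices G := by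
  classical
  intro T
  obtain ⟨m, hm⟩ := Infinite.exists_notMem_finset (T.image fun t => (e t).1)
  have hm' : ∀ t ∈ T, (e t).1 ≠ m := fun t ht h => hm (h ▸ Finset.mem_image_of_mem _ ht)
  refine ⟨e.symm (m, ⟨0, by omega⟩), fun h => hm' _ h (by simp), fun t ht h => hm' t ht ?_⟩
  rw [← e.map_adj_iff, cliqueCopies_adj] at h
  simpa using h.1

/-- A bijective endomorphism maps each component onto a component, so it cannot send vertices of
different components to adjacent vertices. -/
theorem not_isMBHomogeneous_of_iso {n : ℕ} (hn : 2 ≤ n) (e : G ≃g cliqueCopies n) :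
    ¬ IsMBHomogeneous G := by
  classical
  intro h
  have hadj : ∀ x y, G.Adj x y ↔ (e x).1 = (e y).1 ∧ x ≠ y := fun x y => by
    rw [← e.map_adj_iff, cliqueCopies_adj, e.injective.ne_iff]
  let z : Fin n := ⟨0, by omega⟩
  let a := e.symm (0, z)
  let b := e.symm (1, z)
  let c := e.symm (0, ⟨1, by omega⟩)
  have hab : a ≠ b := by simp [a, b]
  have nab : ¬ G.Adj a b := by simp [hadj, a, b]
  have hac : G.Adj a c := by simp [hadj, a, c, z]
  let f : G.induce {a, b} →g G.induce {a, c} :=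
    ⟨fun x => if x.1 = a then ⟨a, by simp⟩ else ⟨c, by simp⟩, by
      rintro ⟨x, rfl | rfl⟩ ⟨y, rfl | rfl⟩ hxy
      · exact (hxy.ne rfl).elim
      · exact (nab hxy).elim
      · exact (nab hxy.symm).elim
      · exact (hxy.ne rfl).elim⟩
  obtain ⟨F, hF, hFf⟩ := h {a, b} {a, c} (by simp) (by simp) f (by
    rintro ⟨x, rfl | rfl⟩ ⟨y, rfl | rfl⟩ hxy
    · rfl
    · simp [f, hab.symm, hac.ne] at hxy
    · simp [f, hab.symm, hac.ne'] at hxy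
    · rfl)
  have Fa : F a = a := by simpa [f] using hFf ⟨a, by simp⟩
  have Fb : F b = c := by simpa [f, hab.symm] using hFf ⟨b, by simp⟩
  have hcomp : ∀ j, (e (F (e.symm (0, j)))).1 = 0 := by
    intro j
    by_cases hj : e.symm (0, j) = a
    · rw [hj, Fa]; simp [a]
    · have := F.map_adj ((hadj (e.symm (0, j)) a).2 ⟨by simp [a], hj⟩)
      rw [hadj, Fa] at this
      simpa [a] using this.1
  have hinj : Function.Injective fun j => (e (F (e.symm (0, j)))).2 := by
    intro i j hij
    have := hF.1 (e.injective (Prod.ext ((hcomp i).trans (hcomp j).symm) hij))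
    simpa using this
  obtain ⟨j, hj⟩ := Finite.surjective_of_injective hinj (e (F b)).2
  have : F (e.symm (0, j)) = F b := e.injective (Prod.ext ((hcomp j).trans (by simp [Fb, c])) hj)
  have := hF.1 this
  simp [b] at this

/-! ### The classification -/

theorem IsMEHomogeneous.trichotomy [Infinite V] (h : IsMEHomogeneous G) :
    (IsCliqueUnion G ∧ G ≠ ⊤) ∨ (IsCliqueUnion Gᶜ ∧ Gᶜ ≠ ⊤) ∨
      (HasCommonNbrs G ∧ HasCommonNbrs Gᶜ) := by
  have hbot : IsCliqueUnion (⊥ : SimpleGraph V) := fun a b c h => h.elim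
  by_cases h1 : IsCliqueUnion G
  · by_cases e : G = ⊤
    · subst e
      rw [compl_top]
      exact Or.inr (Or.inl ⟨hbot, bot_ne_top⟩)
    · exact Or.inl ⟨h1, e⟩
  by_cases h2 : IsCliqueUnion Gᶜ
  · refine Or.inr (Or.inl ⟨h2, fun e => h1 ?_⟩)
    rw [compl_eq_top] at e
    exact e ▸ hbot
  · exact Or.inr (Or.inr (hasCommonNbrs_and_compl h.transfersCommonNbrs
      h.transfersCommonNbrs_compl h1 h2))

theorem IsMEHomogeneous.extendsBack [Infinite V] (h : IsMEHomogeneous G) : ExtendsBack G := by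
  rcases h.trichotomy with ⟨h1, h2⟩ | ⟨h1, h2⟩ | ⟨-, h2⟩
  · exact (h1.hasIsolatedVertices h2 h.transfersCommonNbrs
      h.transfersCommonNbrs_compl).extendsBack
  · exact h1.extendsBack_of_compl h.transfersCommonNbrs_compl
      fun v x hvx => h.infinite_part h1 h2 hvx
  · exact (hasIsolatedVertices_iff_compl.2 h2).extendsBack

theorem IsMEHomogeneous.extendsForth_or_iso [Countable V] [Infinite V] (h : IsMEHomogeneous G) :
    ExtendsForth G ∨ ∃ n : ℕ, 2 ≤ n ∧ Nonempty (G ≃g cliqueCopies n) := by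
  rcases h.trichotomy with ⟨h1, -⟩ | ⟨h1, h2⟩ | ⟨h1, -⟩
  · by_cases hinf : ∀ v x, G.Adj v x → (G.neighborSet v).Infinite
    · exact Or.inl (h1.extendsForth h.transfersCommonNbrs hinf)
    · push Not at hinf
      obtain ⟨v, x, hvx, hfin⟩ := hinf
      obtain ⟨d, hd⟩ := hfin.exists_encard_eq_coe
      refine Or.inr ⟨d + 1, ?_, h1.nonempty_iso_cliqueCopies fun t =>
        ((h.encard_neighborSet_le h1 t v).antisymm (h.encard_neighborSet_le h1 v t)).trans hd⟩
      have hd0 : d ≠ 0 := by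
        rintro rfl
        exact (Set.encard_eq_zero.1 hd).subset hvx
      omega
  · have := h1.hasIsolatedVertices h2 h.transfersCommonNbrs_compl
      (by rw [compl_compl]; exact h.transfersCommonNbrs)
    rw [hasIsolatedVertices_iff_compl, compl_compl] at this
    exact Or.inl this.extendsForth
  · exact Or.inl h1.extendsForth

end GraphHomogeneity

theorem mainTheorem1 {V : Type*} [Countable V] [Infinite V] (G : SimpleGraph V) :
    (GraphHomogeneity.IsMEHomogeneous G ↔ GraphHomogeneity.IsHEHomogeneous G) ∧
    (GraphHomogeneity.IsHEHomogeneous G ↔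
      GraphHomogeneity.IsMBHomogeneous G ∨
        ∃ n : ℕ, 2 ≤ n ∧ Nonempty (G ≃g GraphHomogeneity.cliqueCopies n)) ∧
    ((GraphHomogeneity.IsMEHomogeneous G ∧ ¬ GraphHomogeneity.IsMBHomogeneous G) ↔
      ∃ n : ℕ, 2 ≤ n ∧ Nonempty (G ≃g GraphHomogeneity.cliqueCopies n)) := by
  open GraphHomogeneity in
  have me_he : IsMEHomogeneous G → IsHEHomogeneous G := fun h =>
    isHEHomogeneous_of_extendsBack h.transfersCommonNbrs h.extendsBack
  have he_me : IsHEHomogeneous G → IsMEHomogeneous G := fun h A B hA hB f _ => h A B hA hB f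
  have mb_me : IsMBHomogeneous G → IsMEHomogeneous G := fun h A B hA hB f hf =>
    let ⟨F, hF, hFf⟩ := h A B hA hB f hf
    ⟨F, hF.2, hFf⟩
  have me_cases : IsMEHomogeneous G →
      IsMBHomogeneous G ∨ ∃ n : ℕ, 2 ≤ n ∧ Nonempty (G ≃g cliqueCopies n) := fun h =>
    h.extendsForth_or_iso.imp_left fun hF => isMBHomogeneous_of_extends hF h.extendsBack
  have iso_he : (∃ n : ℕ, 2 ≤ n ∧ Nonempty (G ≃g cliqueCopies n)) → IsHEHomogeneous G :=
    fun ⟨_, hn, ⟨e⟩⟩ => isHEHomogeneous_of_extendsBack (transfersCommonNbrs_of_iso e)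
      (hasIsolatedVertices_of_iso hn e).extendsBack
  exact ⟨⟨me_he, he_me⟩, ⟨fun h => me_cases (he_me h), fun h => h.elim (me_he ∘ mb_me) iso_he⟩,
    fun ⟨h, hn⟩ => (me_cases h).resolve_left hn,
    fun h => ⟨he_me (iso_he h), let ⟨_, hn, ⟨e⟩⟩ := h; not_isMBHomogeneous_of_iso hn e⟩⟩
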